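/- Fix $0<a<1$. In the Asymmetric($a$) system there are two task types $c_1,c_2$ and two experts $s_1,s_2$. Tasks arrive at the instants of a Poisson process of rate $\lambda>0$; the type of each arriving task is unknown to the scheduler and equally likely to be $c_1$ or $c_2$. Attempt durations are independent exponential variables of rate $1$. An attempt on a task succeeds, independently of everything else, with probability $p_{s,c}$, where $p_{s_1,c_1}=p_{s_2,c_1}=1$, $p_{s_1,c_2}=a$, $p_{s_2,c_2}=0$; on success the task leaves, on failure it stays in the system. The mixed type of a task is the posterior distribution of its type given its past attempts; it equals $z'=(1/2,1/2)$ before the first failure and $z''=(0,1)$ afterwards. Several experts may work on the same task. A policy assigns to the experts outstanding tasks (or lets them idle) on the basis of the vector $N(t)=(N_{z'}(t),N_{z''}(t))$ of numbers of outstanding tasks of each mixed type, the past, and possibly randomization; it stabilizes the system if it induces a time-stationary regime. Under the Preemptive Greedy policy, at each time each expert $s$ works on an outstanding task whose mixed type $z$ maximizes the success probability $\sum_c z_c\,p_{s,c}$ among the outstanding tasks, ties being broken uniformly at random. The Preemptive Greedy policy stabilizes the Asymmetric($a$) system if and only if $\lambda<\frac{4a}{2+a}$. This threshold is strictly below the optimal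 throughput, i.e. the supremum of the arrival rates $\lambda$ for which some policy stabilizes the system. For $a=1/2$ the threshold is $4/5$, and the optimal throughput is $25\%$ higher than it. -/

import Mathlib

open scoped NNReal ENNReal

noncomputable section

namespace TaskExpert

/-- Probability that an attempt by expert `s` on a task whose type has distribution `z` fails,
when expert `s` resolves a task of type `c` with probability `p s c`. -/
def failureProb {C S : Type} [Fintype C] (p : S → C → ℝ) (s : S) (z : C → ℝ) : ℝ :=
  ∑ c, z c * (1 - p s c)

/-- Posterior distribution of the type after a failed attempt by expert `s`
(meaningful when the failure probability is nonzero). -/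
def posterior {C S : Type} [Fintype C] (p : S → C → ℝ) (s : S) (z : C → ℝ) : C → ℝ :=
  fun c => z c * (1 - p s c) / failureProb p s z

/-- A task-expert system with finite sets `C` of task types and `S` of experts. -/
structure System (C S : Type) [Fintype C] [Fintype S] where
  /-- success probability of an expert on a task of given (pure) type -/
  p : S → C → ℝ
  p_mem : ∀ s c, p s c ∈ Set.Icc (0 : ℝ) 1
  /-- service rate of each expert: attempts last an exponential time of this parameter -/
  rate : S → ℝ
  rate_pos : ∀ s, 0 < rate s
  /-- intensity of the Poisson process of arrivals -/
  arrivalRate : ℝ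
  arrivalRate_pos : 0 < arrivalRate
  /-- the countable set of mixed types (distributions on the set of types) -/
  Z : Set (C → ℝ)
  Z_countable : Z.Countable
  Z_subset : Z ⊆ stdSimplex ℝ C
  Z_closed : ∀ z ∈ Z, ∀ s, failureProb p s z ≠ 0 → posterior p s z ∈ Z
  /-- law of the mixed type of an arriving task -/
  prior : PMF Z

/-- What happens at an event of the system: a task of mixed type `z` arrives, or the service clock
of an expert rings while he attempts a task of mixed type `z` (with success or failure) or while
he idles. -/
inductive Outcome (S Z : Type) where
  | arrival (z : Z)
  | success (s : S) (z : Z)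
  | failure (s : S) (z : Z)
  | idle (s : S)

namespace System

variable {C S : Type} [Fintype C] [Fintype S] (sys : System C S)

/-- The vector `N = (N_z)` of numbers of outstanding tasks of each mixed type. -/
abbrev State : Type := sys.Z →₀ ℕ

/-- Failure probability on a mixed type of the system. -/
def psi (s : S) (z : sys.Z) : ℝ := failureProb sys.p s z

open Classical in
/-- The mixed type of a task of mixed type `z` after a failed attempt by `s`. (The second branch
is only ever used with probability zero.) -/
def phi (s : S) (z : sys.Z) : sys.Z :=
  if h : failureProb sys.p s z ≠ 0 then ⟨posterior sys.p s z, sys.Z_closed z z.2 s h⟩ else z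

theorem psi_nonneg (s : S) (z : sys.Z) : 0 ≤ sys.psi s z :=
  Finset.sum_nonneg fun c _ =>
    mul_nonneg ((sys.Z_subset z.2).1 c) (sub_nonneg.2 (sys.p_mem s c).2)

theorem psi_le_one (s : S) (z : sys.Z) : sys.psi s z ≤ 1 := by
  rw [← (sys.Z_subset z.2).2]
  exact Finset.sum_le_sum fun c _ =>
    mul_le_of_le_one_right ((sys.Z_subset z.2).1 c) (by linarith [(sys.p_mem s c).1])

/-- Law of the result of an attempt: `true` (failure) with probability `ψ_s(z)`, `false` (success)
with probability `1 - ψ_s(z)`. -/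
def failureLaw (s : S) (z : sys.Z) : PMF Bool :=
  PMF.ofFintype
    (fun b => if b then ENNReal.ofReal (sys.psi s z) else ENNReal.ofReal (1 - sys.psi s z))
    (by
      simp only [Fintype.sum_bool, if_true, Bool.false_eq_true, if_false]
      rw [← ENNReal.ofReal_add (sys.psi_nonneg s z) (sub_nonneg.2 (sys.psi_le_one s z))]
      simp)

/-- Rates of the Poisson clocks that drive the system: the arrivals (`none`), and the service
clock of each expert (`some s`). -/
def clockRate : Option S → ℝ
  | none => sys.arrivalRate
  | some s => sys.rate s

theorem clockRate_pos (e : Option S) : 0 < sys.clockRate e := by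
  cases e with
  | none => exact sys.arrivalRate_pos
  | some s => exact sys.rate_pos s

/-- Total event rate `λ + ∑ s, μ_s`. -/
def totalRate : ℝ := ∑ e, sys.clockRate e

theorem totalRate_pos : 0 < sys.totalRate :=
  Finset.sum_pos (fun e _ => sys.clockRate_pos e) ⟨none, Finset.mem_univ _⟩

/-- Which of the independent clocks rings at an event of their superposition: each with
probability proportional to its rate. -/
def clockLaw : PMF (Option S) :=
  PMF.ofFintype (fun e => ENNReal.ofReal (sys.clockRate e / sys.totalRate)) (by
    rw [← ENNReal.ofReal_sum_of_nonneg
      fun e _ => div_nonneg (sys.clockRate_pos e).le sys.totalRate_pos.le, ← Finset.sum_div]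
    change ENNReal.ofReal (sys.totalRate / sys.totalRate) = 1
    rw [div_self sys.totalRate_pos.ne', ENNReal.ofReal_one])

/-- A scheduling policy. It may base its decisions on the vector `N` and on a memory (taking
countably many values) in which it records what it wants of the past; it may randomize, may let
experts idle, may preempt or not, and may assign several experts to the same task. -/
structure Policy where
  /-- the set of values of the memory -/
  Mem : Type
  mem_countable : Countable Mem
  /-- law of the mixed type of the task on which expert `s` works (`none`: he idles) -/
  assign : sys.State → Mem → S → PMF (Option sys.Z)
  /-- only outstanding tasks can be served -/
  outstanding : ∀ n m s z, assign n m s (some z) ≠ 0 → 0 < n z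
  /-- law of the new memory, given the vector `N` and the memory just before the event, and the
  event -/
  update : sys.State → Mem → Outcome S sys.Z → PMF Mem

namespace Policy

variable {sys} (P : sys.Policy)

/-- Law of the state (and memory) just after the next event, given the present state. -/
def step (x : sys.State × P.Mem) : PMF (sys.State × P.Mem) :=
  sys.clockLaw.bind fun e =>
    match e with
    | none => sys.prior.bind fun z =>
        (P.update x.1 x.2 (.arrival z)).map fun m => (x.1 + Finsupp.single z 1, m)
    | some s => (P.assign x.1 x.2 s).bind fun w =>
        match w with
        | none => (P.update x.1 x.2 (.idle s)).map fun m => (x.1, m)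
        | some z => (sys.failureLaw s z).bind fun failed =>
            if failed then
              (P.update x.1 x.2 (.failure s z)).map fun m =>
                (x.1 - Finsupp.single z 1 + Finsupp.single (sys.phi s z) 1, m)
            else
              (P.update x.1 x.2 (.success s z)).map fun m => (x.1 - Finsupp.single z 1, m)

/-- Law of the state just after the `k`-th event, started from `x`. -/
def stepIter : ℕ → sys.State × P.Mem → PMF (sys.State × P.Mem)
  | 0, x => PMF.pure x
  | k + 1, x => (P.step x).bind (stepIter k)

/-- Transition function of the continuous-time Markov chain: law of the state at time `t`, started
from `x` at time `0`. The number of events up to time `t` is Poisson distributed with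
mean `totalRate * t`, and is independent of what happens at the successive events. -/
def transition (t : ℝ≥0) (x : sys.State × P.Mem) : PMF (sys.State × P.Mem) :=
  (ProbabilityTheory.poissonMeasure (sys.totalRate.toNNReal * t)).toPMF.bind
    fun k => P.stepIter k x

/-- The policy stabilizes the system if it induces a time-stationary regime: there is a
probability distribution of the initial state under which the state has the same law at all
times. -/
def Stabilizes : Prop :=
  ∃ q : PMF (sys.State × P.Mem), ∀ t : ℝ≥0, q.bind (P.transition t) = q

end Policy

/-- Some policy stabilizes the system. -/
def IsStabilizable : Prop := ∃ P : sys.Policy, P.Stabilizes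

open Classical in
/-- Outstanding mixed types with the least failure probability for expert `s`. -/
def greedySet (n : sys.State) (s : S) : Finset sys.Z :=
  n.support.filter fun z => ∀ w ∈ n.support, sys.psi s z ≤ sys.psi s w

theorem greedySet_nonempty {n : sys.State} (h : n ≠ 0) (s : S) : (sys.greedySet n s).Nonempty := by
  obtain ⟨z, hz, hmin⟩ :=
    n.support.exists_min_image (sys.psi s) (Finsupp.support_nonempty_iff.2 h)
  exact ⟨z, Finset.mem_filter.2 ⟨hz, hmin⟩⟩

open Classical in
/-- Law of the mixed type assigned to expert `s`: uniform on the greedy set. -/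
def greedyAssign (n : sys.State) (s : S) : PMF (Option sys.Z) :=
  if h : n = 0 then PMF.pure none
  else (PMF.uniformOfFinset (sys.greedySet n s) (sys.greedySet_nonempty h s)).map some

/-- The Preemptive Greedy policy: at each time each expert works on an outstanding task with the
highest success probability for him, ties being broken uniformly at random. It has no memory. -/
def preemptiveGreedy : sys.Policy where
  Mem := Unit
  mem_countable := inferInstance
  assign n _ s := sys.greedyAssign n s
  outstanding n _ s z h := by
    by_cases hn : n = 0
    · simp [greedyAssign, hn] at h
    · have h' : some z ∈ (sys.greedyAssign n s).support := h
      simp only [greedyAssign, hn, dif_neg, not_false_eq_true, PMF.mem_support_map_iff,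
        PMF.mem_support_uniformOfFinset_iff, Option.some.injEq, exists_eq_right] at h'
      exact Nat.pos_of_ne_zero (Finsupp.mem_support_iff.1 (Finset.mem_filter.1 h').1)
  update _ _ _ := PMF.pure ()

end System

/-- Success probabilities of the Asymmetric(a) system: experts `0, 1` are `s₁, s₂`, types `0, 1`
are `c₁, c₂`. -/
def asymmetricP (a : ℝ) : Fin 2 → Fin 2 → ℝ := ![![1, a], ![1, 0]]

/-- The mixed type `z'` of every arriving task. -/
def mixedNew : Fin 2 → ℝ := ![1 / 2, 1 / 2]

/-- The mixed type `z''` of a task that has received a failure. -/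
def mixedFailed : Fin 2 → ℝ := ![0, 1]

/-- The Asymmetric(a) system with arrival rate `lam`. -/
def asymmetric (a lam : ℝ) (ha₀ : 0 < a) (ha₁ : a < 1) (hlam : 0 < lam) :
    System (Fin 2) (Fin 2) where
  p := asymmetricP a
  p_mem s c := by
    fin_cases s <;> fin_cases c <;> simp [asymmetricP, ha₀.le, ha₁.le]
  rate _ := 1
  rate_pos _ := one_pos
  arrivalRate := lam
  arrivalRate_pos := hlam
  Z := {mixedNew, mixedFailed}
  Z_countable := (Set.toFinite _).countable
  Z_subset := by
    rintro z (rfl | rfl)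
    · refine ⟨fun c => ?_, ?_⟩
      · fin_cases c <;> norm_num [mixedNew]
      · norm_num [mixedNew, Fin.sum_univ_two]
    · refine ⟨fun c => ?_, ?_⟩
      · fin_cases c <;> norm_num [mixedFailed]
      · norm_num [mixedFailed, Fin.sum_univ_two]
  Z_closed := by
    have h1 : 1 - a ≠ 0 := by linarith
    rintro z (rfl | rfl) s - <;> right <;> funext c <;> fin_cases s <;> fin_cases c <;>
      simp [posterior, failureProb, asymmetricP, mixedNew, mixedFailed, Fin.sum_univ_two, h1]
  prior := PMF.pure ⟨mixedNew, Or.inl rfl⟩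

end TaskExpert

end

/-!
A law is stationary for the continuous-time chain if and only if it is invariant for the chain
observed at its events, so everything is read off the generator. On a linear value
`∑ z, N_z * w z` the generator depends on the state only through the assignment, and its mean
under an invariant law is zero.

Under Preemptive Greedy both experts work on `z'` whenever `N_{z'} ≠ 0`. The value
`α N_{z'} + N_{z''}` then drifts at rate `1 - a / 2 - (2 - λ) α` while `N_{z'} ≠ 0` and at rate
`λ α - a` while only `z''` is outstanding. Some `α` makes both rates negative exactly when
`λ < 4 a / (2 + a)`, and Foster's criterion applies. Otherwise `a N_{z'} + λ N_{z''}` drifts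
nonnegatively everywhere and upwards in the empty state, which an invariant law must charge.

For an arbitrary policy, the values `N_{z'} / 2 + N_{z''}` and `(1 + a) / 2 * N_{z'} + N_{z''}`
give `λ ≤ 2 a` and `λ ≤ 3 a / (1 + a)`. Conversely, below both bounds a slight dilution of the
service rates that attain them is a randomized assignment independent of the state which serves
each mixed type faster than it is produced, and `N_{z'} ^ 2 + N_{z''} ^ 2` is a Lyapunov function.
-/

noncomputable section

namespace TaskExpert

open Filter Topology

section Expectation

variable {α β : Type*}

/-- Expectation of an `ℝ≥0∞`-valued function under a discrete probability distribution. -/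
def lexpect (p : PMF α) (g : α → ℝ≥0∞) : ℝ≥0∞ := ∑' x, p x * g x

theorem lexpect_pure (x : α) (g : α → ℝ≥0∞) : lexpect (PMF.pure x) g = g x := by
  rw [lexpect, tsum_eq_single x fun y hy => by simp [PMF.pure_apply, hy]]
  simp [PMF.pure_apply]

theorem lexpect_bind (p : PMF α) (f : α → PMF β) (g : β → ℝ≥0∞) :
    lexpect (p.bind f) g = lexpect p fun x => lexpect (f x) g := by
  simp only [lexpect, PMF.bind_apply, ← ENNReal.tsum_mul_right, ← ENNReal.tsum_mul_left]
  rw [ENNReal.tsum_comm]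
  simp only [mul_assoc]

theorem lexpect_map (p : PMF α) (f : α → β) (g : β → ℝ≥0∞) :
    lexpect (p.map f) g = lexpect p fun x => g (f x) := by
  simp only [PMF.map, lexpect_bind, Function.comp, lexpect_pure]

theorem lexpect_const (p : PMF α) (c : ℝ≥0∞) : lexpect p (fun _ => c) = c := by
  rw [lexpect, ENNReal.tsum_mul_right, p.tsum_coe, one_mul]

theorem lexpect_add (p : PMF α) (g h : α → ℝ≥0∞) :
    lexpect p (fun x => g x + h x) = lexpect p g + lexpect p h := by
  simp only [lexpect, mul_add, ENNReal.tsum_add]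

theorem lexpect_mono {p : PMF α} {g h : α → ℝ≥0∞} (hgh : ∀ x, p x ≠ 0 → g x ≤ h x) :
    lexpect p g ≤ lexpect p h := by
  refine ENNReal.tsum_le_tsum fun x => ?_
  rcases eq_or_ne (p x) 0 with hx | hx
  · simp [hx]
  · exact mul_le_mul_right (hgh x hx) _

open Classical in
theorem lexpect_ite_mem_finset (p : PMF α) (F : Finset α) (b : ℝ≥0∞) :
    lexpect p (fun x => if x ∈ F then b else 0) = b * ∑ x ∈ F, p x := by
  rw [lexpect, tsum_eq_sum (s := F) fun x hx => by simp [hx], Finset.mul_sum]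
  exact Finset.sum_congr rfl fun x hx => by rw [if_pos hx, mul_comm]

theorem pmf_eq_of_le {p q : PMF α} (h : ∀ x, p x ≤ q x) : p = q := by
  refine PMF.ext fun x => ?_
  by_contra hx
  exact (ENNReal.tsum_lt_tsum p.tsum_coe_ne_top h (lt_of_le_of_ne (h x) hx)).ne
    (p.tsum_coe.trans q.tsum_coe.symm)

/-- Expectation of a real function under a probability distribution on a finite type. -/
def expect [Fintype α] (p : PMF α) (g : α → ℝ) : ℝ := ∑ x, (p x).toReal * g x

variable [Fintype α] {p : PMF α}

theorem expect_pure (x : α) (g : α → ℝ) : expect (PMF.pure x) g = g x := by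
  classical
  simp [expect, PMF.pure_apply, apply_ite ENNReal.toReal]

theorem expect_add (g h : α → ℝ) :
    expect p (fun x => g x + h x) = expect p g + expect p h := by
  simp only [expect, mul_add, Finset.sum_add_distrib]

theorem expect_const_mul (c : ℝ) (g : α → ℝ) :
    expect p (fun x => c * g x) = c * expect p g := by
  simp only [expect, Finset.mul_sum, mul_left_comm]

theorem expect_const (c : ℝ) : expect p (fun _ => c) = c := by
  have hsum : ∑ x, (p x).toReal = 1 := by
    rw [← ENNReal.toReal_sum fun x _ => p.apply_ne_top x,
      (tsum_fintype p).symm.trans p.tsum_coe, ENNReal.toReal_one]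
  rw [expect, ← Finset.sum_mul, hsum, one_mul]

theorem expect_sub_const (g : α → ℝ) (c : ℝ) :
    expect p (fun x => g x - c) = expect p g - c := by
  simp only [sub_eq_add_neg, expect_add, expect_const]

theorem expect_mono {g h : α → ℝ} (hgh : ∀ x, p x ≠ 0 → g x ≤ h x) : expect p g ≤ expect p h := by
  refine Finset.sum_le_sum fun x _ => ?_
  rcases eq_or_ne (p x) 0 with hx | hx
  · simp [hx]
  · exact mul_le_mul_of_nonneg_left (hgh x hx) ENNReal.toReal_nonneg

theorem expect_nonneg {g : α → ℝ} (hg : ∀ x, p x ≠ 0 → 0 ≤ g x) : 0 ≤ expect p g :=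
  (expect_const 0).symm.trans_le (expect_mono hg)

theorem expect_congr {g h : α → ℝ} (hgh : ∀ x, p x ≠ 0 → g x = h x) : expect p g = expect p h :=
  (expect_mono fun x hx => (hgh x hx).le).antisymm (expect_mono fun x hx => (hgh x hx).ge)

theorem lexpect_ofReal {g : α → ℝ} (hg : ∀ x, 0 ≤ g x) :
    lexpect p (fun x => ENNReal.ofReal (g x)) = ENNReal.ofReal (expect p g) := by
  rw [lexpect, tsum_fintype, expect,
    ENNReal.ofReal_sum_of_nonneg fun x _ => mul_nonneg ENNReal.toReal_nonneg (hg x)]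
  refine Finset.sum_congr rfl fun x _ => ?_
  rw [ENNReal.ofReal_mul ENNReal.toReal_nonneg, ENNReal.ofReal_toReal (p.apply_ne_top x)]

theorem expect_map [Fintype β] (f : α → β) (g : β → ℝ) :
    expect (p.map f) g = expect p fun x => g (f x) := by
  classical
  have hmap (y : β) : (p.map f y).toReal = ∑ x, if y = f x then (p x).toReal else 0 := by
    rw [PMF.map_apply, tsum_fintype, ENNReal.toReal_sum fun x _ => by
      split_ifs <;> simp [p.apply_ne_top]]
    exact Finset.sum_congr rfl fun x _ => by split_ifs <;> rfl
  simp only [expect, hmap, Finset.sum_mul]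
  rw [Finset.sum_comm]
  simp

/-- Law of a random variable that equals `u` with probability `t` and `v` with probability
`1 - t`. -/
def twoPoint (t : Set.Icc (0 : ℝ) 1) (u v : β) : PMF β :=
  (PMF.ofFintype (fun b => if b then ENNReal.ofReal t else ENNReal.ofReal (1 - t)) (by
    simp only [Fintype.sum_bool, if_true, Bool.false_eq_true, if_false]
    rw [← ENNReal.ofReal_add t.2.1 (sub_nonneg.2 t.2.2), add_sub_cancel, ENNReal.ofReal_one])).map
    fun b : Bool => if b then u else v

theorem expect_twoPoint [Fintype β] (t : Set.Icc (0 : ℝ) 1) (u v : β) (g : β → ℝ) :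
    expect (twoPoint t u v) g = t * g u + (1 - t) * g v := by
  rw [twoPoint, expect_map]
  simp [expect, ENNReal.toReal_ofReal t.2.1, ENNReal.toReal_ofReal (sub_nonneg.2 t.2.2)]

end Expectation

section Invariance

variable {X : Type*} {K : X → PMF X} {q : PMF X}

theorem lexpect_lexpect_of_invariant (hq : q.bind K = q) (g : X → ℝ≥0∞) :
    lexpect q (fun x => lexpect (K x) g) = lexpect q g := by
  rw [← lexpect_bind, hq]

theorem ne_zero_of_invariant (hq : q.bind K = q) {x y : X} (hx : q x ≠ 0) (hxy : K x y ≠ 0) :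
    q y ≠ 0 := by
  rw [← hq, ← PMF.mem_support_iff, PMF.mem_support_bind_iff]
  exact ⟨x, hx, hxy⟩

variable {V : X → ℝ≥0} {d : X → ℝ≥0∞} {B : ℝ≥0}

theorem min_add_drift_le_lexpect_min
    (hinc : ∀ x y, K x y ≠ 0 → V y ≤ V x + B ∧ V x ≤ V y + B)
    (hdrift : ∀ x, V x + d x ≤ lexpect (K x) fun y => V y) (M : ℝ≥0) (x : X) :
    (min (V x) M : ℝ≥0) + (if V x + B ≤ M then d x else 0) ≤
      lexpect (K x) (fun y => (min (V y) M : ℝ≥0)) + if V x + B ≤ M then 0 else (B : ℝ≥0∞) := by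
  split_ifs with hx
  · calc ((min (V x) M : ℝ≥0) : ℝ≥0∞) + d x
        ≤ V x + d x := by gcongr; exact min_le_left _ _
      _ ≤ lexpect (K x) fun y => V y := hdrift x
      _ ≤ lexpect (K x) (fun y => (min (V y) M : ℝ≥0)) + 0 := by
        rw [add_zero]
        exact lexpect_mono fun y hy =>
          ENNReal.coe_le_coe.2 (le_min le_rfl ((hinc x y hy).1.trans hx))
  · rw [add_zero, ← lexpect_const (K x) (min (V x) M : ℝ≥0), ← lexpect_const (K x) B,
      ← lexpect_add]
    refine lexpect_mono fun y hy => ?_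
    rw [← ENNReal.coe_add, ENNReal.coe_le_coe, ← min_add_add_right]
    exact min_le_min (hinc x y hy).2 le_self_add

theorem lexpect_drift_le_of_invariant (hq : q.bind K = q)
    (hinc : ∀ x y, K x y ≠ 0 → V y ≤ V x + B ∧ V x ≤ V y + B)
    (hdrift : ∀ x, V x + d x ≤ lexpect (K x) fun y => V y) (M : ℝ≥0) :
    lexpect q (fun x => if V x + B ≤ M then d x else 0) ≤
      lexpect q fun x => if V x + B ≤ M then 0 else (B : ℝ≥0∞) := by
  have hfinite : lexpect q (fun x => ((min (V x) M : ℝ≥0) : ℝ≥0∞)) ≠ ∞ := by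
    refine ne_top_of_le_ne_top (ENNReal.coe_ne_top (r := M)) ?_
    rw [← lexpect_const q M]
    exact lexpect_mono fun x _ => ENNReal.coe_le_coe.2 (min_le_right _ _)
  rw [← ENNReal.add_le_add_iff_left hfinite, ← lexpect_add]
  refine (lexpect_mono fun x _ => min_add_drift_le_lexpect_min hinc hdrift M x).trans_eq ?_
  rw [lexpect_add, lexpect_lexpect_of_invariant hq]

-- `V` need not be integrable: the drift inequality is integrated for `min V M`, where it can fail
-- only on `{V > M - B}`, whose probability vanishes as `M → ∞`.
theorem drift_eq_zero_of_invariant (hq : q.bind K = q)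
    (hinc : ∀ x y, K x y ≠ 0 → V y ≤ V x + B ∧ V x ≤ V y + B)
    (hdrift : ∀ x, V x + d x ≤ lexpect (K x) fun y => V y) {x₀ : X} (hx₀ : q x₀ ≠ 0) :
    d x₀ = 0 := by
  classical
  have htail (T : Finset X) : q x₀ * d x₀ ≤ (∑' x : {x // x ∉ T}, q x) * B := by
    obtain ⟨M, hM⟩ := ((insert x₀ T).image fun x => V x + B).bddAbove
    replace hM : ∀ x ∈ insert x₀ T, V x + B ≤ M := fun x hx =>
      hM (Finset.mem_coe.2 (Finset.mem_image_of_mem _ hx))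
    calc q x₀ * d x₀
        = q x₀ * (if V x₀ + B ≤ M then d x₀ else 0) := by
          rw [if_pos (hM x₀ (Finset.mem_insert_self _ _))]
      _ ≤ lexpect q (fun x => if V x + B ≤ M then d x else 0) := ENNReal.le_tsum x₀
      _ ≤ lexpect q (fun x => if V x + B ≤ M then 0 else (B : ℝ≥0∞)) :=
          lexpect_drift_le_of_invariant hq hinc hdrift M
      _ ≤ ∑' x, Set.indicator {x | x ∉ T} q x * B := by
          refine ENNReal.tsum_le_tsum fun x => ?_
          by_cases hx : x ∈ T
          · simp [hM x (Finset.mem_insert_of_mem hx)]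
          · rw [Set.indicator_of_mem (show x ∈ {x | x ∉ T} from hx)]
            gcongr
            dsimp only
            split_ifs <;> simp
      _ = (∑' x : {x // x ∉ T}, q x) * B := by
          rw [ENNReal.tsum_mul_right, ← tsum_subtype {x | x ∉ T} q]
          rfl
  have hlim : Tendsto (fun T : Finset X => (∑' x : {x // x ∉ T}, q x) * (B : ℝ≥0∞)) atTop
      (𝓝 (0 * B)) :=
    ENNReal.Tendsto.mul_const (ENNReal.tendsto_tsum_compl_atTop_zero q.tsum_coe_ne_top)
      (Or.inr ENNReal.coe_ne_top)
  have hzero : q x₀ * d x₀ = 0 :=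
    le_antisymm ((ge_of_tendsto' hlim htail).trans_eq (zero_mul _)) zero_le
  exact (mul_eq_zero.1 hzero).resolve_left hx₀

end Invariance

section Foster

variable {X : Type*} (K : X → PMF X) (x₀ : X)

/-- Law after `n` steps of the Markov chain with transition law `K` started from `x₀`. -/
def chainLaw : ℕ → PMF X
  | 0 => PMF.pure x₀
  | n + 1 => (chainLaw n).bind K

/-- Average of the laws of the chain at the times `0, …, n`. -/
def occupation (n : ℕ) : PMF X :=
  (PMF.uniformOfFintype (Fin (n + 1))).bind fun k => chainLaw K x₀ k

theorem lexpect_occupation (n : ℕ) (g : X → ℝ≥0∞) :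
    lexpect (occupation K x₀ n) g =
      ((n + 1 : ℕ) : ℝ≥0∞)⁻¹ * ∑ k ∈ Finset.range (n + 1), lexpect (chainLaw K x₀ k) g := by
  rw [occupation, lexpect_bind, lexpect, tsum_fintype, Finset.mul_sum,
    ← Fin.sum_univ_eq_sum_range fun k => _ * lexpect (chainLaw K x₀ k) g]
  simp only [PMF.uniformOfFintype_apply, Fintype.card_fin]

theorem occupation_apply (n : ℕ) (x : X) :
    occupation K x₀ n x =
      ((n + 1 : ℕ) : ℝ≥0∞)⁻¹ * ∑ k ∈ Finset.range (n + 1), chainLaw K x₀ k x := by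
  classical
  simpa only [lexpect_ite_mem_finset, Finset.sum_singleton, one_mul]
    using lexpect_occupation K x₀ n fun y => if y ∈ ({x} : Finset X) then 1 else 0

theorem occupation_bind_le (n : ℕ) (y : X) :
    (occupation K x₀ n).bind K y ≤ occupation K x₀ n y + ((n + 1 : ℕ) : ℝ≥0∞)⁻¹ := by
  have hsucc (k : ℕ) : lexpect (chainLaw K x₀ k) (fun x => K x y) = chainLaw K x₀ (k + 1) y :=
    (PMF.bind_apply _ _ _).symm
  calc (occupation K x₀ n).bind K y
      = ((n + 1 : ℕ) : ℝ≥0∞)⁻¹ * ∑ k ∈ Finset.range (n + 1), chainLaw K x₀ (k + 1) y := by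
        simp only [← hsucc, ← lexpect_occupation]
        exact PMF.bind_apply _ _ _
    _ ≤ ((n + 1 : ℕ) : ℝ≥0∞)⁻¹ * (∑ k ∈ Finset.range (n + 1), chainLaw K x₀ k y + 1) := by
        gcongr
        refine (le_self_add (b := chainLaw K x₀ 0 y)).trans ?_
        rw [← Finset.sum_range_succ' fun k => chainLaw K x₀ k y, Finset.sum_range_succ]
        gcongr
        exact PMF.coe_le_one _ _
    _ = occupation K x₀ n y + ((n + 1 : ℕ) : ℝ≥0∞)⁻¹ := by
        rw [occupation_apply, mul_add, mul_one]

theorem tendsto_inv_natCast_succ :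
    Tendsto (fun n : ℕ => ((n + 1 : ℕ) : ℝ≥0∞)⁻¹) atTop (𝓝 0) :=
  ENNReal.tendsto_inv_nat_nhds_zero.comp (tendsto_add_atTop_nat 1)

variable {K} {V f : X → ℝ≥0∞} {ε : ℝ≥0∞}

theorem lexpect_chainLaw_add_le (hdrift : ∀ x, lexpect (K x) V + ε ≤ V x + f x) (n : ℕ) :
    lexpect (chainLaw K x₀ n) V + n * ε ≤
      V x₀ + ∑ k ∈ Finset.range n, lexpect (chainLaw K x₀ k) f := by
  induction n with
  | zero => simp [chainLaw, lexpect_pure]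
  | succ n ih =>
    have hstep : lexpect (chainLaw K x₀ (n + 1)) V + ε ≤
        lexpect (chainLaw K x₀ n) V + lexpect (chainLaw K x₀ n) f := by
      rw [chainLaw, lexpect_bind, ← lexpect_const (chainLaw K x₀ n) ε, ← lexpect_add,
        ← lexpect_add]
      exact lexpect_mono fun x _ => hdrift x
    calc lexpect (chainLaw K x₀ (n + 1)) V + (n + 1 : ℕ) * ε
        = lexpect (chainLaw K x₀ (n + 1)) V + ε + n * ε := by push_cast; ring
      _ ≤ lexpect (chainLaw K x₀ n) V + lexpect (chainLaw K x₀ n) f + n * ε := by gcongr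
      _ = lexpect (chainLaw K x₀ n) V + n * ε + lexpect (chainLaw K x₀ n) f := by ring
      _ ≤ V x₀ + ∑ k ∈ Finset.range n, lexpect (chainLaw K x₀ k) f +
          lexpect (chainLaw K x₀ n) f := by gcongr
      _ = V x₀ + ∑ k ∈ Finset.range (n + 1), lexpect (chainLaw K x₀ k) f := by
        rw [Finset.sum_range_succ, add_assoc]

theorem le_lexpect_occupation (hdrift : ∀ x, lexpect (K x) V + ε ≤ V x + f x) (n : ℕ) :
    ε ≤ V x₀ * ((n + 1 : ℕ) : ℝ≥0∞)⁻¹ + lexpect (occupation K x₀ n) f := by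
  have hn : ((n + 1 : ℕ) : ℝ≥0∞) ≠ 0 := Nat.cast_ne_zero.2 n.succ_ne_zero
  calc ε = ((n + 1 : ℕ) : ℝ≥0∞)⁻¹ * ((n + 1 : ℕ) * ε) := by
        rw [← mul_assoc, ENNReal.inv_mul_cancel hn (ENNReal.natCast_ne_top _), one_mul]
    _ ≤ ((n + 1 : ℕ) : ℝ≥0∞)⁻¹ *
        (V x₀ + ∑ k ∈ Finset.range (n + 1), lexpect (chainLaw K x₀ k) f) := by
        gcongr
        exact le_add_self.trans (lexpect_chainLaw_add_le x₀ hdrift (n + 1))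
    _ = V x₀ * ((n + 1 : ℕ) : ℝ≥0∞)⁻¹ + lexpect (occupation K x₀ n) f := by
        rw [lexpect_occupation, mul_add, mul_comm (V x₀)]

theorem tsum_mul_le_of_tendsto {ι : Type*} {l : Filter ι} [l.NeBot] {p : ι → PMF X}
    {μ g : X → ℝ≥0∞} {u : ι → ℝ≥0∞} {c : ℝ≥0∞} (hμ : ∀ x, Tendsto (fun i => p i x) l (𝓝 (μ x)))
    (hg : ∀ x, g x ≠ ∞) (hle : ∀ i, lexpect (p i) g ≤ u i) (hu : Tendsto u l (𝓝 c)) :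
    ∑' x, μ x * g x ≤ c := by
  rw [ENNReal.tsum_eq_iSup_sum]
  refine iSup_le fun T => le_of_tendsto_of_tendsto' ?_ hu fun i =>
    (ENNReal.sum_le_tsum T).trans (hle i)
  exact tendsto_finsetSum T fun x _ => ENNReal.Tendsto.mul_const (hμ x) (Or.inr (hg x))

theorem exists_invariant_of_subinvariant {μ : X → ℝ≥0∞} (h₀ : ∑' x, μ x ≠ 0)
    (htop : ∑' x, μ x ≠ ∞) (hμ : ∀ y, ∑' x, μ x * K x y ≤ μ y) : ∃ q : PMF X, q.bind K = q := by
  refine ⟨PMF.normalize μ h₀ htop, pmf_eq_of_le fun y => ?_⟩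
  simp only [PMF.bind_apply, PMF.normalize_apply, mul_right_comm _ (∑' x, μ x)⁻¹]
  rw [ENNReal.tsum_mul_right]
  gcongr
  exact hμ y

theorem exists_invariant_of_le_sum_occupation (F : Finset X) {u : ℕ → ℝ≥0∞} {δ : ℝ≥0∞}
    (hδ : δ ≠ 0) (hu : Tendsto u atTop (𝓝 0)) {b : ℝ≥0∞} (hb : b ≠ ∞)
    (hle : ∀ n, δ ≤ u n + b * ∑ x ∈ F, occupation K x₀ n x) : ∃ q : PMF X, q.bind K = q := by
  let U : Ultrafilter ℕ := hyperfilter ℕ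
  have hU : (U : Filter ℕ) ≤ atTop := Nat.hyperfilter_le_atTop
  have hlim (x : X) : ∃ l, Tendsto (fun n => occupation K x₀ n x) U (𝓝 l) :=
    ⟨_, (U.map fun n => occupation K x₀ n x).le_nhds_lim⟩
  choose μ hμ using hlim
  have hmass : ∑' x, μ x ≤ 1 := by
    simpa only [mul_one] using tsum_mul_le_of_tendsto hμ (g := fun _ => 1)
      (fun _ => ENNReal.one_ne_top) (fun n => (lexpect_const _ 1).le) tendsto_const_nhds
  have hsub (y : X) : ∑' x, μ x * K x y ≤ μ y := by
    refine tsum_mul_le_of_tendsto hμ (fun x => PMF.apply_ne_top _ _)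
      (fun n => (PMF.bind_apply _ _ _).ge.trans (occupation_bind_le K x₀ n y)) ?_
    simpa only [add_zero] using (hμ y).add (tendsto_inv_natCast_succ.mono_left hU)
  have hFlim : Tendsto (fun n => u n + b * ∑ x ∈ F, occupation K x₀ n x) U
      (𝓝 (b * ∑ x ∈ F, μ x)) := by
    simpa only [zero_add] using (hu.mono_left hU).add
      (ENNReal.Tendsto.const_mul (tendsto_finsetSum F fun x _ => hμ x) (Or.inr hb))
  refine exists_invariant_of_subinvariant ?_ (ne_top_of_le_ne_top ENNReal.one_ne_top hmass) hsub
  intro h₀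
  have hFzero : ∑ x ∈ F, μ x = 0 := le_antisymm ((ENNReal.sum_le_tsum F).trans h₀.le) zero_le
  rw [hFzero, mul_zero] at hFlim
  exact hδ (le_antisymm (ge_of_tendsto' hFlim hle) zero_le)

theorem exists_invariant_of_foster (F : Finset X) {ε : ℝ≥0} (hε : 0 < ε) (hx₀ : V x₀ ≠ ∞)
    (hF : ∀ x ∈ F, lexpect (K x) V ≠ ∞) (hdrift : ∀ x ∉ F, lexpect (K x) V + ε ≤ V x) :
    ∃ q : PMF X, q.bind K = q := by
  classical
  let b : ℝ≥0∞ := ∑ x ∈ F, lexpect (K x) V + ε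
  have hb : b ≠ ∞ := ENNReal.add_ne_top.2 ⟨ENNReal.sum_ne_top.2 hF, ENNReal.coe_ne_top⟩
  have hdrift' (x : X) : lexpect (K x) V + ε ≤ V x + if x ∈ F then b else 0 := by
    split_ifs with hx
    · exact le_add_left (add_le_add_left
        (Finset.single_le_sum (f := fun x => lexpect (K x) V) (fun _ _ => zero_le) hx) _)
    · simpa only [add_zero] using hdrift x hx
  have hinv : Tendsto (fun n : ℕ => V x₀ * ((n + 1 : ℕ) : ℝ≥0∞)⁻¹) atTop (𝓝 0) := by
    simpa only [mul_zero] using ENNReal.Tendsto.const_mul tendsto_inv_natCast_succ (Or.inr hx₀)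
  refine exists_invariant_of_le_sum_occupation x₀ F (ENNReal.coe_ne_zero.2 hε.ne') hinv hb
    fun n => ?_
  rw [← lexpect_ite_mem_finset]
  exact le_lexpect_occupation x₀ hdrift' n

end Foster

theorem le_of_forall_add_mul_le_exp_mul {r s : ℝ}
    (h : ∀ θ > 0, r + θ * s ≤ Real.exp θ * r) : s ≤ r := by
  have hslope : Tendsto (fun θ : ℝ => θ⁻¹ * (Real.exp θ * r - r)) (𝓝[>] 0) (𝓝 r) := by
    simpa using ((Real.hasDerivAt_exp 0).mul_const r).tendsto_slope_zero_right
  refine ge_of_tendsto hslope ?_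
  filter_upwards [self_mem_nhdsWithin] with θ hθ
  rw [le_inv_mul_iff₀ hθ]
  linarith [h θ hθ]

namespace System

variable {C S : Type} [Fintype C] [Fintype S] {sys : System C S}

section Stationarity

variable (P : sys.Policy) {q : PMF (sys.State × P.Mem)}

theorem bind_stepIter_of_invariant (hq : q.bind P.step = q) (k : ℕ) :
    q.bind (P.stepIter k) = q := by
  induction k with
  | zero => exact PMF.bind_pure q
  | succ k ih =>
    change (q.bind fun x => (P.step x).bind (P.stepIter k)) = q
    rw [← PMF.bind_bind, hq, ih]

-- The terms of the Poisson mixture for zero and one event, divided by `exp (-θ)`.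
theorem add_mul_le_exp_mul_of_bind_transition {θ : ℝ} (hθ : 0 < θ)
    (hq : q.bind (P.transition (θ / sys.totalRate).toNNReal) = q) (y : sys.State × P.Mem) :
    (q y).toReal + θ * (q.bind P.step y).toReal ≤ Real.exp θ * (q y).toReal := by
  have hmean : sys.totalRate.toNNReal * (θ / sys.totalRate).toNNReal = θ.toNNReal := by
    rw [← Real.toNNReal_mul sys.totalRate_pos.le, mul_div_cancel₀ _ sys.totalRate_pos.ne']
  have hzero : q.bind (P.stepIter 0) = q := PMF.bind_pure q
  have hone : q.bind (P.stepIter 1) = q.bind P.step :=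
    congrArg q.bind (funext fun x => PMF.bind_pure (P.step x))
  have hmixture : ∑ k ∈ Finset.range 2,
      (ProbabilityTheory.poissonMeasure θ.toNNReal).toPMF k * q.bind (P.stepIter k) y ≤ q y := by
    refine (ENNReal.sum_le_tsum _).trans_eq ?_
    rw [← PMF.bind_apply, ← PMF.bind_comm, ← hmean]
    exact DFunLike.congr_fun hq y
  have htwo : ENNReal.ofReal (Real.exp (-θ)) * q y +
      ENNReal.ofReal (Real.exp (-θ) * θ) * q.bind P.step y ≤ q y := by
    simpa [-PMF.bind_apply, Finset.sum_range_succ, hzero, hone, hθ.le,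
      MeasureTheory.Measure.toPMF_apply, ProbabilityTheory.poissonMeasure_singleton] using hmixture
  have hreal := ENNReal.toReal_mono (q.apply_ne_top y) htwo
  rw [ENNReal.toReal_add (ENNReal.mul_ne_top ENNReal.ofReal_ne_top (q.apply_ne_top y))
    (ENNReal.mul_ne_top ENNReal.ofReal_ne_top (PMF.apply_ne_top _ y)), ENNReal.toReal_mul,
    ENNReal.toReal_mul, ENNReal.toReal_ofReal (Real.exp_pos _).le,
    ENNReal.toReal_ofReal (by positivity), mul_assoc, ← mul_add, Real.exp_neg,
    inv_mul_le_iff₀ (Real.exp_pos θ)] at hreal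
  exact hreal

theorem stabilizes_iff_exists_bind_step_eq :
    P.Stabilizes ↔ ∃ q : PMF (sys.State × P.Mem), q.bind P.step = q := by
  refine exists_congr fun q => ⟨fun h => pmf_eq_of_le fun y => ?_, fun hq t => ?_⟩
  · exact (ENNReal.toReal_le_toReal (PMF.apply_ne_top _ _) (PMF.apply_ne_top _ _)).1
      (le_of_forall_add_mul_le_exp_mul fun θ hθ =>
        add_mul_le_exp_mul_of_bind_transition P hθ (h _) y)
  · unfold Policy.transition
    rw [PMF.bind_comm]
    simp only [bind_stepIter_of_invariant P hq, PMF.bind_const]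

end Stationarity

section Generator

open Finsupp (single)

namespace Policy

variable (P : sys.Policy)

theorem fst_of_step_ne_zero {x y : sys.State × P.Mem} (h : P.step x y ≠ 0) :
    y.1 = x.1 ∨ (∃ z, y.1 = x.1 + single z 1) ∨ ∃ z, y.1 = x.1 - single z 1 ∨
      ∃ s, y.1 = x.1 - single z 1 + single (sys.phi s z) 1 := by
  rw [← PMF.mem_support_iff, step, PMF.mem_support_bind_iff] at h
  obtain ⟨_ | s, -, h⟩ := h
  · obtain ⟨z, -, h⟩ := (PMF.mem_support_bind_iff _ _ _).1 h
    obtain ⟨m, -, rfl⟩ := (PMF.mem_support_map_iff _ _ _).1 h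
    exact Or.inr (Or.inl ⟨z, rfl⟩)
  · obtain ⟨_ | z, -, h⟩ := (PMF.mem_support_bind_iff _ _ _).1 h
    · obtain ⟨m, -, rfl⟩ := (PMF.mem_support_map_iff _ _ _).1 h
      exact Or.inl rfl
    · obtain ⟨_ | _, -, h⟩ := (PMF.mem_support_bind_iff _ _ _).1 h
      · obtain ⟨m, -, rfl⟩ := (PMF.mem_support_map_iff _ _ _).1 h
        exact Or.inr (Or.inr ⟨z, Or.inl rfl⟩)
      · obtain ⟨m, -, rfl⟩ := (PMF.mem_support_map_iff _ _ _).1 h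
        exact Or.inr (Or.inr ⟨z, Or.inr ⟨s, rfl⟩⟩)

theorem abs_sub_le_one_of_step_ne_zero {x y : sys.State × P.Mem} (h : P.step x y ≠ 0)
    (z : sys.Z) : |(y.1 z : ℝ) - x.1 z| ≤ 1 := by
  classical
  suffices hnat : y.1 z ≤ x.1 z + 1 ∧ x.1 z ≤ y.1 z + 1 by
    rw [abs_sub_le_iff, sub_le_iff_le_add', sub_le_iff_le_add']
    exact_mod_cast hnat
  obtain h | ⟨w, h⟩ | ⟨w, h | ⟨s, h⟩⟩ := P.fst_of_step_ne_zero h <;>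
    grind [Finsupp.add_apply, Finsupp.tsub_apply]

end Policy

/-- Mean of `v` at the vector `N` just after the service clock of expert `s` has rung while he was
working on a task of the given mixed type (`none`: while he was idle). -/
def attemptMean (v : sys.State → ℝ) (n : sys.State) (s : S) : Option sys.Z → ℝ
  | none => v n
  | some z =>
    sys.psi s z * v (n - single z 1 + single (sys.phi s z) 1) +
      (1 - sys.psi s z) * v (n - single z 1)

theorem expect_failureLaw (s : S) (z : sys.Z) (g : Bool → ℝ) :
    expect (sys.failureLaw s z) g = sys.psi s z * g true + (1 - sys.psi s z) * g false := by
  simp [expect, failureLaw, sys.psi_nonneg, sys.psi_le_one]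

theorem attemptMean_nonneg {v : sys.State → ℝ} (hv : ∀ n, 0 ≤ v n) (n : sys.State) (s : S)
    (w : Option sys.Z) : 0 ≤ attemptMean v n s w := by
  cases w with
  | none => exact hv n
  | some z =>
    exact add_nonneg (mul_nonneg (sys.psi_nonneg s z) (hv _))
      (mul_nonneg (sub_nonneg.2 (sys.psi_le_one s z)) (hv _))

theorem totalRate_mul_expect_clockLaw (g : Option S → ℝ) :
    sys.totalRate * expect sys.clockLaw g =
      sys.arrivalRate * g none + ∑ s, sys.rate s * g (some s) := by
  have hterm (e : Option S) :
      sys.totalRate * ((sys.clockLaw e).toReal * g e) = sys.clockRate e * g e := by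
    rw [clockLaw, PMF.ofFintype_apply,
      ENNReal.toReal_ofReal (div_nonneg (sys.clockRate_pos e).le sys.totalRate_pos.le),
      ← mul_assoc, mul_div_cancel₀ _ sys.totalRate_pos.ne']
  simp only [expect, Finset.mul_sum, hterm]
  exact Fintype.sum_option _

variable [Fintype sys.Z]

namespace Policy

variable (P : sys.Policy)

/-- Mean of `v` at the vector `N` just after the next event. -/
def stepMean (v : sys.State → ℝ) (x : sys.State × P.Mem) : ℝ :=
  expect sys.clockLaw fun e =>
    match e with
    | none => expect sys.prior fun z => v (x.1 + single z 1)
    | some s => expect (P.assign x.1 x.2 s) (attemptMean v x.1 s)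

/-- Infinitesimal generator of the continuous-time chain, applied to a function `v` of the
vector `N`. -/
def generator (v : sys.State → ℝ) (x : sys.State × P.Mem) : ℝ :=
  sys.totalRate * (P.stepMean v x - v x.1)

theorem stepMean_eq_add_generator_div (v : sys.State → ℝ) (x : sys.State × P.Mem) :
    P.stepMean v x = v x.1 + P.generator v x / sys.totalRate := by
  rw [generator, mul_div_cancel_left₀ _ sys.totalRate_pos.ne', add_sub_cancel]

theorem generator_eq (v : sys.State → ℝ) (x : sys.State × P.Mem) :
    P.generator v x =
      sys.arrivalRate * expect sys.prior (fun z => v (x.1 + single z 1) - v x.1) +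
        ∑ s, sys.rate s *
          expect (P.assign x.1 x.2 s) (fun w => attemptMean v x.1 s w - v x.1) := by
  rw [generator, stepMean, ← expect_sub_const, totalRate_mul_expect_clockLaw]
  simp only [expect_sub_const]

variable {v : sys.State → ℝ}

theorem stepMean_nonneg (hv : ∀ n, 0 ≤ v n) (x : sys.State × P.Mem) : 0 ≤ P.stepMean v x :=
  expect_nonneg fun e _ => by
    cases e with
    | none => exact expect_nonneg fun z _ => hv _
    | some s => exact expect_nonneg fun w _ => attemptMean_nonneg hv _ _ _

theorem lexpect_step_ofReal (hv : ∀ n, 0 ≤ v n) (x : sys.State × P.Mem) :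
    lexpect (P.step x) (fun y => ENNReal.ofReal (v y.1)) = ENNReal.ofReal (P.stepMean v x) := by
  rw [step, lexpect_bind, stepMean, ← lexpect_ofReal fun e => ?nonneg]
  case nonneg =>
    cases e with
    | none => exact expect_nonneg fun z _ => hv _
    | some s => exact expect_nonneg fun w _ => attemptMean_nonneg hv _ _ _
  congr 1
  funext e
  cases e with
  | none =>
    simp only [lexpect_bind, lexpect_map, lexpect_const]
    exact lexpect_ofReal fun z => hv _
  | some s =>
    simp only [lexpect_bind]
    rw [← lexpect_ofReal fun w => attemptMean_nonneg hv _ _ _]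
    congr 1
    funext w
    cases w with
    | none => simp only [lexpect_map, lexpect_const, attemptMean]
    | some z =>
      have hmean : attemptMean v x.1 s (some z) = expect (sys.failureLaw s z) fun failed =>
          v (if failed then x.1 - single z 1 + single (sys.phi s z) 1 else x.1 - single z 1) := by
        simp [expect_failureLaw, attemptMean]
      rw [hmean, ← lexpect_ofReal fun _ => hv _, lexpect_bind]
      congr 1
      funext failed
      cases failed <;>
        simp only [if_true, Bool.false_eq_true, if_false, lexpect_map, lexpect_const]

theorem stabilizes_of_generator_le [Finite P.Mem] (m₀ : P.Mem) (hv : ∀ n, 0 ≤ v n)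
    {F : Set sys.State} (hF : F.Finite) {ε : ℝ} (hε : 0 < ε)
    (hdrift : ∀ x : sys.State × P.Mem, x.1 ∉ F → P.generator v x ≤ -ε) : P.Stabilizes := by
  have hfinite : (F ×ˢ (Set.univ : Set P.Mem)).Finite := hF.prod Set.finite_univ
  have hrate : 0 < ε / sys.totalRate := div_pos hε sys.totalRate_pos
  rw [stabilizes_iff_exists_bind_step_eq]
  refine exists_invariant_of_foster (0, m₀) (V := fun x => ENNReal.ofReal (v x.1))
    hfinite.toFinset (Real.toNNReal_pos.2 hrate) ENNReal.ofReal_ne_top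
    (fun x _ => ?_) fun x hx => ?_
  · rw [lexpect_step_ofReal P hv]
    exact ENNReal.ofReal_ne_top
  · have hxF : x.1 ∉ F := fun h => hx (hfinite.mem_toFinset.2 ⟨h, Set.mem_univ _⟩)
    have hgen : P.generator v x / sys.totalRate ≤ -(ε / sys.totalRate) := by
      rw [← neg_div]
      exact div_le_div_of_nonneg_right (hdrift x hxF) sys.totalRate_pos.le
    rw [lexpect_step_ofReal P hv, ← ENNReal.ofReal,
      ← ENNReal.ofReal_add (P.stepMean_nonneg hv x) hrate.le]
    refine ENNReal.ofReal_le_ofReal ?_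
    rw [stepMean_eq_add_generator_div]
    linarith

theorem generator_eq_zero_of_invariant {q : PMF (sys.State × P.Mem)} (hq : q.bind P.step = q)
    (hv : ∀ n, 0 ≤ v n) {B : ℝ} (hinc : ∀ x y, P.step x y ≠ 0 → |v y.1 - v x.1| ≤ B)
    (hgen : ∀ x, 0 ≤ P.generator v x) {x : sys.State × P.Mem} (hx : q x ≠ 0) :
    P.generator v x = 0 := by
  have hstep (x y : sys.State × P.Mem) (h : P.step x y ≠ 0) :
      (v y.1).toNNReal ≤ (v x.1).toNNReal + B.toNNReal ∧
        (v x.1).toNNReal ≤ (v y.1).toNNReal + B.toNNReal := by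
    obtain ⟨hlow, hupp⟩ := abs_le.1 (hinc x y h)
    exact ⟨(Real.toNNReal_le_toNNReal (by linarith)).trans Real.toNNReal_add_le,
      (Real.toNNReal_le_toNNReal (by linarith)).trans Real.toNNReal_add_le⟩
  have hmean (x : sys.State × P.Mem) :
      ENNReal.ofReal (v x.1) + ENNReal.ofReal (P.generator v x / sys.totalRate) =
        lexpect (P.step x) fun y => ENNReal.ofReal (v y.1) := by
    rw [lexpect_step_ofReal P hv, stepMean_eq_add_generator_div,
      ENNReal.ofReal_add (hv _) (div_nonneg (hgen x) sys.totalRate_pos.le)]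
  have hdrift : ENNReal.ofReal (P.generator v x / sys.totalRate) = 0 :=
    drift_eq_zero_of_invariant (V := fun y => (v y.1).toNNReal)
      (d := fun y => ENNReal.ofReal (P.generator v y / sys.totalRate)) hq hstep
      (fun y => (hmean y).le) hx
  have hle := ENNReal.ofReal_eq_zero.1 hdrift
  rw [div_le_iff₀ sys.totalRate_pos, zero_mul] at hle
  exact le_antisymm hle (hgen x)

end Policy

end Generator

section LinearFunctions

open Finsupp (single linearCombination)

/-- Mean change of `∑ z, N_z * w z` when expert `s` completes an attempt on a task of the given
mixed type (`none`: he was idle). -/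
def attemptGain (w : sys.Z → ℝ) (s : S) : Option sys.Z → ℝ
  | none => 0
  | some z => sys.psi s z * w (sys.phi s z) - w z

theorem attemptMean_linearCombination_sub (w : sys.Z → ℝ) {n : sys.State} {s : S}
    {o : Option sys.Z} (ho : ∀ z, o = some z → 0 < n z) :
    attemptMean (linearCombination ℕ w) n s o - linearCombination ℕ w n = attemptGain w s o := by
  cases o with
  | none => exact sub_self _
  | some z =>
    have hle : single z 1 ≤ n := Finsupp.single_le_iff.2 (ho z rfl)
    have hremove : linearCombination ℕ w (n - single z 1) = linearCombination ℕ w n - w z := by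
      rw [eq_sub_iff_add_eq, ← one_smul ℕ (w z), ← Finsupp.linearCombination_single, ← map_add,
        tsub_add_cancel_of_le hle]
    simp only [attemptMean, attemptGain, map_add, hremove, Finsupp.linearCombination_single,
      one_smul]
    ring

theorem linearCombination_nonneg {w : sys.Z → ℝ} (hw : ∀ z, 0 ≤ w z) (n : sys.State) :
    0 ≤ linearCombination ℕ w n :=
  Finset.sum_nonneg fun z _ => nsmul_nonneg (hw z) _

theorem attemptGain_add (w w' : sys.Z → ℝ) (s : S) (o : Option sys.Z) :
    attemptGain (w + w') s o = attemptGain w s o + attemptGain w' s o := by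
  cases o <;> simp only [attemptGain, Pi.add_apply] <;> ring

theorem attemptGain_smul (c : ℝ) (w : sys.Z → ℝ) (s : S) (o : Option sys.Z) :
    attemptGain (c • w) s o = c * attemptGain w s o := by
  cases o <;> simp only [attemptGain, Pi.smul_apply, smul_eq_mul] <;> ring

variable [Fintype sys.Z]

variable (sys) in
/-- Rate of change of `∑ z, N_z * w z` when each expert `s` works on a task whose mixed type has
law `σ s`. -/
def valueDrift (σ : S → PMF (Option sys.Z)) (w : sys.Z → ℝ) : ℝ :=
  sys.arrivalRate * expect sys.prior w + ∑ s, sys.rate s * expect (σ s) (attemptGain w s)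

namespace Policy

variable (P : sys.Policy)

theorem generator_linearCombination (w : sys.Z → ℝ) (x : sys.State × P.Mem) :
    P.generator (linearCombination ℕ w) x = sys.valueDrift (P.assign x.1 x.2) w := by
  have harrival (z : sys.Z) :
      linearCombination ℕ w (x.1 + single z 1) - linearCombination ℕ w x.1 = w z := by
    rw [map_add, add_sub_cancel_left, Finsupp.linearCombination_single, one_smul]
  rw [generator_eq, valueDrift, funext harrival]
  congr! 3 with s
  exact expect_congr fun o ho => attemptMean_linearCombination_sub w fun z hz =>
    P.outstanding x.1 x.2 s z (hz ▸ ho)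

theorem abs_linearCombination_sub_le {x y : sys.State × P.Mem} (h : P.step x y ≠ 0)
    (w : sys.Z → ℝ) :
    |linearCombination ℕ w y.1 - linearCombination ℕ w x.1| ≤ ∑ z, |w z| := by
  simp only [Finsupp.linearCombination_apply, nsmul_eq_mul, Nat.cast_zero, zero_mul,
    Finsupp.sum_fintype, implies_true, ← Finset.sum_sub_distrib, ← sub_mul]
  refine (Finset.abs_sum_le_sum_abs _ _).trans (Finset.sum_le_sum fun z _ => ?_)
  rw [abs_mul]
  exact mul_le_of_le_one_left (abs_nonneg _) (P.abs_sub_le_one_of_step_ne_zero h z)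

theorem valueDrift_eq_zero_of_invariant {q : PMF (sys.State × P.Mem)} (hq : q.bind P.step = q)
    {w : sys.Z → ℝ} (hw : ∀ z, 0 ≤ w z)
    (hdrift : ∀ x : sys.State × P.Mem, 0 ≤ sys.valueDrift (P.assign x.1 x.2) w)
    {x : sys.State × P.Mem} (hx : q x ≠ 0) : sys.valueDrift (P.assign x.1 x.2) w = 0 := by
  simp only [← generator_linearCombination] at hdrift ⊢
  exact P.generator_eq_zero_of_invariant hq (linearCombination_nonneg hw)
    (fun _ _ h => P.abs_linearCombination_sub_le h w) hdrift hx

-- Weak duality: otherwise the value `∑ z, N_z * w z` would drift upwards in every state.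
theorem Stabilizes.arrivalRate_mul_expect_le {P : sys.Policy} (hP : P.Stabilizes) {w : sys.Z → ℝ}
    (hw : ∀ z, 0 ≤ w z) {c : S → ℝ} (hc : ∀ s, 0 ≤ c s)
    (hcost : ∀ s z, w z - sys.psi s z * w (sys.phi s z) ≤ c s) :
    sys.arrivalRate * expect sys.prior w ≤ ∑ s, sys.rate s * c s := by
  by_contra! hlt
  obtain ⟨q, hq⟩ := (stabilizes_iff_exists_bind_step_eq P).1 hP
  have hgain (s : S) (o : Option sys.Z) : -c s ≤ attemptGain w s o := by
    cases o with
    | none => exact neg_nonpos.2 (hc s)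
    | some z => exact (neg_le_neg (hcost s z)).trans_eq (neg_sub _ _)
  have hpos (x : sys.State × P.Mem) : 0 < sys.valueDrift (P.assign x.1 x.2) w := by
    calc 0 < sys.arrivalRate * expect sys.prior w + ∑ s, sys.rate s * -c s := by
          simpa only [mul_neg, Finset.sum_neg_distrib, ← sub_eq_add_neg, sub_pos] using hlt
      _ ≤ sys.valueDrift (P.assign x.1 x.2) w := by
          unfold valueDrift
          gcongr with s
          · exact (sys.rate_pos s).le
          · exact (expect_const _).symm.trans_le (expect_mono fun o _ => hgain s o)
  obtain ⟨x, hx⟩ := q.support_nonempty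
  exact (hpos x).ne' (P.valueDrift_eq_zero_of_invariant hq hw (fun y => (hpos y).le) hx)

end Policy

end LinearFunctions

section Emptying

open Finsupp (single)

namespace Policy

variable (P : sys.Policy)

theorem exists_step_sub_single_ne_zero {x : sys.State × P.Mem} {s : S} {z : sys.Z}
    (hz : P.assign x.1 x.2 s (some z) ≠ 0) (hψ : sys.psi s z < 1) :
    ∃ m, P.step x (x.1 - single z 1, m) ≠ 0 := by
  obtain ⟨m, hm⟩ := (P.update x.1 x.2 (.success s z)).support_nonempty
  have hclock : some s ∈ sys.clockLaw.support := by
    simp [clockLaw, div_pos (sys.clockRate_pos (some s)) sys.totalRate_pos]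
  have hsuccess : false ∈ (sys.failureLaw s z).support := by
    simp [failureLaw, hψ]
  refine ⟨m, (PMF.mem_support_bind_iff _ _ _).2 ⟨some s, hclock,
    (PMF.mem_support_bind_iff _ _ _).2 ⟨some z, hz,
      (PMF.mem_support_bind_iff _ _ _).2 ⟨false, hsuccess, ?_⟩⟩⟩⟩
  exact (PMF.mem_support_map_iff _ _ _).2 ⟨m, hm, rfl⟩

theorem exists_zero_ne_zero_of_invariant {q : PMF (sys.State × P.Mem)} (hq : q.bind P.step = q)
    (hserve : ∀ x : sys.State × P.Mem, x.1 ≠ 0 →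
      ∃ s z, P.assign x.1 x.2 s (some z) ≠ 0 ∧ sys.psi s z < 1) :
    ∃ m, q (0, m) ≠ 0 := by
  obtain ⟨x, hx⟩ := q.support_nonempty
  rw [PMF.mem_support_iff] at hx
  induction hk : x.1.degree generalizing x with
  | zero => exact ⟨x.2, (Finsupp.degree_eq_zero_iff x.1).1 hk ▸ hx⟩
  | succ k ih =>
    have hne : x.1 ≠ 0 := fun h => by simp [h] at hk
    obtain ⟨s, z, hz, hψ⟩ := hserve x hne
    obtain ⟨m, hm⟩ := P.exists_step_sub_single_ne_zero hz hψ
    refine ih _ (ne_zero_of_invariant hq hx hm) ?_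
    have hle : single z 1 ≤ x.1 := Finsupp.single_le_iff.2 (P.outstanding _ _ _ _ hz)
    have hdegree : (x.1 - single z 1).degree + 1 = x.1.degree := by
      simpa only [map_add, Finsupp.degree_single] using
        congrArg Finsupp.degree (tsub_add_cancel_of_le hle)
    exact Nat.succ_injective (hdegree.trans hk)

end Policy

end Emptying

section Greedy

theorem greedySet_eq_singleton {n : sys.State} {s : S} {z : sys.Z} (hz : n z ≠ 0)
    (hlt : ∀ w, n w ≠ 0 → w ≠ z → sys.psi s z < sys.psi s w) : sys.greedySet n s = {z} := by
  ext w
  simp only [greedySet, Finset.mem_filter, Finsupp.mem_support_iff, Finset.mem_singleton]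
  constructor
  · rintro ⟨hw, hmin⟩
    by_contra hwz
    exact (hmin z hz).not_gt (hlt w hw hwz)
  · rintro rfl
    refine ⟨hz, fun u hu => ?_⟩
    rcases eq_or_ne u w with rfl | huw
    · exact le_rfl
    · exact (hlt u hu huw).le

theorem greedyAssign_eq_pure {n : sys.State} {s : S} {z : sys.Z} (hz : n z ≠ 0)
    (hlt : ∀ w, n w ≠ 0 → w ≠ z → sys.psi s z < sys.psi s w) :
    sys.greedyAssign n s = PMF.pure (some z) := by
  have hn : n ≠ 0 := fun h => hz (by rw [h, Finsupp.zero_apply])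
  have huniform : PMF.uniformOfFinset _ (sys.greedySet_nonempty hn s) = PMF.pure z := by
    ext w
    simp [PMF.uniformOfFinset_apply, PMF.pure_apply, greedySet_eq_singleton hz hlt]
  rw [greedyAssign, dif_neg hn, huniform, PMF.pure_map]

end Greedy

section StaticPolicy

open Finsupp (single)

/-- The policy under which expert `s`, independently of the past, chooses a mixed type with law
`σ s`, and idles when no task of that mixed type is outstanding. -/
def staticPolicy (σ : S → PMF (Option sys.Z)) : sys.Policy where
  Mem := Unit
  mem_countable := inferInstance
  assign n _ s := (σ s).map (Option.filter fun z => n z ≠ 0)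
  outstanding n _ s z h := by
    obtain ⟨o, -, ho⟩ := (PMF.mem_support_map_iff _ _ _).1 ((PMF.mem_support_iff _ _).2 h)
    simpa [Nat.pos_iff_ne_zero] using (Option.filter_eq_some_iff.1 ho).2
  update _ _ _ := PMF.pure ()

variable [Fintype sys.Z]

/-- The Lyapunov function `∑ z, N_z ^ 2`. -/
def sumSq (n : sys.State) : ℝ := ∑ z, (n z : ℝ) ^ 2

theorem sumSq_nonneg (n : sys.State) : 0 ≤ sumSq n := Finset.sum_nonneg fun _ _ => sq_nonneg _

theorem sumSq_add_single (n : sys.State) (z : sys.Z) :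
    sumSq (n + single z 1) = sumSq n + 2 * n z + 1 := by
  classical
  have hterm (w : sys.Z) : ((n + single z 1 : sys.State) w : ℝ) ^ 2 =
      (n w : ℝ) ^ 2 + if z = w then 2 * (n w : ℝ) + 1 else 0 := by
    rw [Finsupp.add_apply, Finsupp.single_apply]
    split_ifs <;> push_cast <;> ring
  simp only [sumSq, hterm, Finset.sum_add_distrib, Finset.sum_ite_eq, Finset.mem_univ, if_true]
  ring

theorem sumSq_sub_single {n : sys.State} {z : sys.Z} (hz : n z ≠ 0) :
    sumSq (n - single z 1) = sumSq n - 2 * n z + 1 := by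
  have hle : single z 1 ≤ n := Finsupp.single_le_iff.2 (Nat.pos_of_ne_zero hz)
  have hadd := sumSq_add_single (n - single z 1) z
  rw [tsub_add_cancel_of_le hle, Finsupp.tsub_apply, Finsupp.single_eq_same,
    Nat.cast_sub (Nat.one_le_iff_ne_zero.2 hz), Nat.cast_one] at hadd
  linarith

theorem attemptMean_sumSq_sub_le (n : sys.State) (s : S) (o : Option sys.Z) :
    attemptMean sumSq n s (o.filter fun z => n z ≠ 0) - sumSq n ≤
      2 * attemptGain (fun z => (n z : ℝ)) s o + 2 := by
  cases o with
  | none => simp [attemptMean, attemptGain]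
  | some z =>
    have hψ₀ := sys.psi_nonneg s z
    have hψ₁ := sys.psi_le_one s z
    rcases eq_or_ne (n z) 0 with hz | hz
    · have hgain : 0 ≤ sys.psi s z * n (sys.phi s z) := mul_nonneg hψ₀ (Nat.cast_nonneg _)
      simp only [Option.filter_some, hz, ne_eq, not_true_eq_false, decide_false,
        Bool.false_eq_true, if_false, attemptMean, sub_self, attemptGain, Nat.cast_zero, sub_zero]
      linarith
    · have hphi : ((n - single z 1 : sys.State) (sys.phi s z) : ℝ) ≤ n (sys.phi s z) := by
        exact_mod_cast Nat.sub_le _ _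
      simp only [Option.filter_some, hz, ne_eq, not_false_eq_true, decide_true, if_true,
        attemptMean, attemptGain, sumSq_add_single, sumSq_sub_single hz]
      nlinarith [mul_le_mul_of_nonneg_left hphi hψ₀]

theorem generator_staticPolicy_sumSq_le (σ : S → PMF (Option sys.Z))
    (x : sys.State × (staticPolicy σ).Mem) :
    (staticPolicy σ).generator sumSq x ≤
      2 * sys.valueDrift σ (fun z => (x.1 z : ℝ)) +
        (sys.arrivalRate + 2 * ∑ s, sys.rate s) := by
  have harrival (z : sys.Z) : sumSq (x.1 + single z 1) - sumSq x.1 = 2 * x.1 z + 1 := by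
    rw [sumSq_add_single]; ring
  have hattempt (s : S) : expect ((staticPolicy σ).assign x.1 x.2 s)
      (fun o => attemptMean sumSq x.1 s o - sumSq x.1) ≤
        2 * expect (σ s) (attemptGain (fun z => (x.1 z : ℝ)) s) + 2 := by
    change expect ((σ s).map (Option.filter fun z => x.1 z ≠ 0)) _ ≤ _
    rw [expect_map]
    refine (expect_mono fun o _ => attemptMean_sumSq_sub_le x.1 s o).trans_eq ?_
    rw [expect_add, expect_const_mul, expect_const]
  calc (staticPolicy σ).generator sumSq x
      ≤ sys.arrivalRate * (2 * expect sys.prior (fun z => (x.1 z : ℝ)) + 1) +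
        ∑ s, sys.rate s * (2 * expect (σ s) (attemptGain (fun z => (x.1 z : ℝ)) s) + 2) := by
        rw [Policy.generator_eq, funext harrival, expect_add, expect_const_mul, expect_const]
        gcongr with s
        · exact (sys.rate_pos s).le
        · exact hattempt s
    _ = 2 * sys.valueDrift σ (fun z => (x.1 z : ℝ)) +
        (sys.arrivalRate + 2 * ∑ s, sys.rate s) := by
        simp only [valueDrift, mul_add, Finset.sum_add_distrib, ← Finset.sum_mul,
          mul_left_comm _ (2 : ℝ), ← Finset.mul_sum]
        ring

theorem isLinearMap_valueDrift (σ : S → PMF (Option sys.Z)) :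
    IsLinearMap ℝ (sys.valueDrift σ) where
  map_add w w' := by
    have hprior : expect sys.prior (w + w') = expect sys.prior w + expect sys.prior w' :=
      expect_add w w'
    simp only [valueDrift, hprior, funext (attemptGain_add w w' _), expect_add, mul_add,
      Finset.sum_add_distrib]
    ring
  map_smul c w := by
    have hprior : expect sys.prior (c • w) = c * expect sys.prior w := expect_const_mul c w
    simp only [valueDrift, hprior, funext (attemptGain_smul c w _), expect_const_mul,
      mul_left_comm _ c, ← Finset.mul_sum, ← mul_add, smul_eq_mul]

theorem valueDrift_eq_sum (σ : S → PMF (Option sys.Z)) (w : sys.Z → ℝ) :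
    sys.valueDrift σ w = ∑ z, w z * sys.valueDrift σ (Pi.single z 1) := by
  let drift := (isLinearMap_valueDrift σ).mk' _
  calc drift w = ∑ z, drift (Pi.single z (w z)) := by rw [← map_sum, Finset.univ_sum_single]
    _ = ∑ z, w z * drift (Pi.single z 1) := by
        refine Finset.sum_congr rfl fun z _ => ?_
        rw [← smul_eq_mul (w z), ← map_smul, ← Pi.single_smul, smul_eq_mul, mul_one]

theorem staticPolicy_stabilizes {σ : S → PMF (Option sys.Z)}
    (hσ : ∀ z, sys.valueDrift σ (Pi.single z 1) < 0) : (staticPolicy σ).Stabilizes := by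
  have : Nonempty sys.Z := ⟨sys.prior.support_nonempty.some⟩
  have : Finite (staticPolicy σ).Mem := inferInstanceAs (Finite Unit)
  obtain ⟨z₀, hz₀⟩ := Finite.exists_max fun z => sys.valueDrift σ (Pi.single z 1)
  let δ : ℝ := -sys.valueDrift σ (Pi.single z₀ 1)
  have hδ : 0 < δ := neg_pos.2 (hσ z₀)
  let C : ℝ := sys.arrivalRate + 2 * ∑ s, sys.rate s
  obtain ⟨M, hM⟩ := exists_nat_ge ((C + 1) / (2 * δ))
  rw [div_le_iff₀ (by positivity)] at hM
  refine Policy.stabilizes_of_generator_le _ () sumSq_nonneg (Finsupp.finite_of_degree_le M)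
    one_pos fun x hx => ?_
  have hdegree : (M : ℝ) ≤ ∑ z, (x.1 z : ℝ) := by
    have hlt : M < x.1.degree := not_le.1 hx
    rw [Finsupp.degree_eq_sum] at hlt
    exact_mod_cast hlt.le
  have hdrift : sys.valueDrift σ (fun z => (x.1 z : ℝ)) ≤ -(∑ z, (x.1 z : ℝ)) * δ := by
    rw [valueDrift_eq_sum, ← Finset.sum_neg_distrib, Finset.sum_mul]
    refine Finset.sum_le_sum fun z _ => ?_
    rw [neg_mul_neg]
    exact mul_le_mul_of_nonneg_left (hz₀ z) (Nat.cast_nonneg _)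
  have hgenerator := generator_staticPolicy_sumSq_le σ x
  nlinarith [mul_le_mul_of_nonneg_right hdegree hδ.le]

end StaticPolicy

end System

open TaskExpert.System

section Asymmetric

variable {a lam : ℝ} {ha₀ : 0 < a} {ha₁ : a < 1} {hlam : 0 < lam}

local notation "sys" => asymmetric a lam ha₀ ha₁ hlam

/-- The mixed type `z'` in the Asymmetric(a) system. -/
def zNew : (asymmetric a lam ha₀ ha₁ hlam).Z := ⟨mixedNew, Or.inl rfl⟩

/-- The mixed type `z''` in the Asymmetric(a) system. -/
def zFailed : (asymmetric a lam ha₀ ha₁ hlam).Z := ⟨mixedFailed, Or.inr rfl⟩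

theorem zFailed_ne_zNew : (zFailed : (sys).Z) ≠ zNew := by
  intro h
  have hcoord := congrFun (congrArg Subtype.val h) 0
  norm_num [zNew, zFailed, mixedNew, mixedFailed] at hcoord

theorem forall_mixedType {p : (sys).Z → Prop} : (∀ z, p z) ↔ p zNew ∧ p zFailed := by
  refine ⟨fun h => ⟨h _, h _⟩, ?_⟩
  rintro ⟨hnew, hfailed⟩ ⟨z, rfl | rfl⟩
  exacts [hnew, hfailed]

instance : Fintype (sys).Z where
  elems := {zNew, zFailed}
  complete := forall_mixedType.2 ⟨by simp, by simp⟩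

theorem psi_zero_zNew : (sys).psi 0 zNew = (1 - a) / 2 := by
  simp [psi, failureProb, asymmetric, asymmetricP, zNew, mixedNew]
  ring

theorem psi_one_zNew : (sys).psi 1 zNew = 1 / 2 := by
  simp [psi, failureProb, asymmetric, asymmetricP, zNew, mixedNew]

theorem psi_zero_zFailed : (sys).psi 0 zFailed = 1 - a := by
  simp [psi, failureProb, asymmetric, asymmetricP, zFailed, mixedFailed]

theorem psi_one_zFailed : (sys).psi 1 zFailed = 1 := by
  simp [psi, failureProb, asymmetric, asymmetricP, zFailed, mixedFailed]

theorem psi_zNew_lt_psi_zFailed (s : Fin 2) : (sys).psi s zNew < (sys).psi s zFailed := by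
  fin_cases s
  · exact psi_zero_zNew.trans_lt ((by linarith : (1 - a) / 2 < 1 - a).trans_eq
      psi_zero_zFailed.symm)
  · exact psi_one_zNew.trans_lt (one_half_lt_one.trans_eq psi_one_zFailed.symm)

theorem psi_pos (s : Fin 2) (z : (sys).Z) : 0 < (sys).psi s z := by
  have hnew : 0 < (sys).psi s zNew := by
    fin_cases s
    · exact psi_zero_zNew.trans_gt (by linarith)
    · exact psi_one_zNew.trans_gt one_half_pos
  revert z
  exact forall_mixedType.2 ⟨hnew, hnew.trans (psi_zNew_lt_psi_zFailed s)⟩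

theorem posterior_eq_mixedFailed (s : Fin 2) (z : (sys).Z) :
    posterior (sys).p s z = mixedFailed := by
  have ha : 1 - a ≠ 0 := by linarith
  revert z
  refine forall_mixedType.2 ⟨funext fun c => ?_, funext fun c => ?_⟩
  all_goals
    fin_cases s <;> fin_cases c <;>
      simp [posterior, failureProb, asymmetric, asymmetricP, zNew, zFailed, mixedNew, mixedFailed,
        ha]

theorem phi_eq_zFailed (s : Fin 2) (z : (sys).Z) : (sys).phi s z = zFailed :=
  (dif_pos (psi_pos s z).ne').trans (Subtype.ext (posterior_eq_mixedFailed s z))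

theorem attemptGain_some (w : (sys).Z → ℝ) (s : Fin 2) (z : (sys).Z) :
    attemptGain w s (some z) = (sys).psi s z * w zFailed - w z := by
  rw [attemptGain, phi_eq_zFailed]

theorem expect_prior (w : (sys).Z → ℝ) : expect (sys).prior w = w zNew := expect_pure _ _

theorem valueDrift_asymmetric (σ : Fin 2 → PMF (Option (sys).Z)) (w : (sys).Z → ℝ) :
    (sys).valueDrift σ w =
      lam * w zNew + (expect (σ 0) (attemptGain w 0) + expect (σ 1) (attemptGain w 1)) := by
  rw [valueDrift, expect_prior, Fin.sum_univ_two]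
  simp only [asymmetric, one_mul]

/-- The weights `α` on `z'` and `β` on `z''`, giving the value `α N_{z'} + β N_{z''}`. -/
def weight (α β : ℝ) (z : (asymmetric a lam ha₀ ha₁ hlam).Z) : ℝ := if z = zNew then α else β

@[simp]
theorem weight_zNew (α β : ℝ) : weight α β (zNew : (sys).Z) = α := if_pos rfl

@[simp]
theorem weight_zFailed (α β : ℝ) : weight α β (zFailed : (sys).Z) = β := if_neg zFailed_ne_zNew

theorem weight_nonneg {α β : ℝ} (hα : 0 ≤ α) (hβ : 0 ≤ β) (z : (sys).Z) : 0 ≤ weight α β z := by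
  unfold weight
  split_ifs <;> assumption

section PreemptiveGreedy

variable {n : (asymmetric a lam ha₀ ha₁ hlam).State}

theorem greedyAssign_of_zNew (hn : n zNew ≠ 0) (s : Fin 2) :
    (sys).greedyAssign n s = PMF.pure (some zNew) :=
  greedyAssign_eq_pure hn (forall_mixedType.2
    ⟨fun _ h => (h rfl).elim, fun _ _ => psi_zNew_lt_psi_zFailed s⟩)

theorem greedyAssign_of_zFailed (hn : n zNew = 0) (hn' : n zFailed ≠ 0) (s : Fin 2) :
    (sys).greedyAssign n s = PMF.pure (some zFailed) :=
  greedyAssign_eq_pure hn' (forall_mixedType.2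
    ⟨fun h => (h hn).elim, fun _ h => (h rfl).elim⟩)

variable (w : (asymmetric a lam ha₀ ha₁ hlam).Z → ℝ)

theorem valueDrift_greedyAssign_zero :
    (sys).valueDrift ((sys).greedyAssign 0) w = lam * w zNew := by
  have hidle (s : Fin 2) : (sys).greedyAssign 0 s = PMF.pure none := dif_pos rfl
  simp only [valueDrift_asymmetric, hidle, expect_pure, attemptGain, add_zero]

theorem valueDrift_greedyAssign_of_zNew (hn : n zNew ≠ 0) :
    (sys).valueDrift ((sys).greedyAssign n) w =
      (1 - a / 2) * w zFailed - (2 - lam) * w zNew := by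
  simp only [valueDrift_asymmetric, greedyAssign_of_zNew hn, expect_pure, attemptGain_some,
    psi_zero_zNew, psi_one_zNew]
  ring

theorem valueDrift_greedyAssign_of_zFailed (hn : n zNew = 0) (hn' : n zFailed ≠ 0) :
    (sys).valueDrift ((sys).greedyAssign n) w = lam * w zNew - a * w zFailed := by
  simp only [valueDrift_asymmetric, greedyAssign_of_zFailed hn hn', expect_pure, attemptGain_some,
    psi_zero_zFailed, psi_one_zFailed]
  ring

theorem state_trichotomy (n : (sys).State) :
    n = 0 ∨ n zNew ≠ 0 ∨ n zNew = 0 ∧ n zFailed ≠ 0 := by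
  rw [Finsupp.ext_iff, forall_mixedType]
  simp only [Finsupp.zero_apply]
  tauto

theorem preemptiveGreedy_stabilizes (h : lam < 4 * a / (2 + a)) :
    (sys).preemptiveGreedy.Stabilizes := by
  rw [lt_div_iff₀ (by linarith)] at h
  have hlam₂ : 0 < 2 - lam := by nlinarith
  obtain ⟨α, hα, hα'⟩ : ∃ α, (1 - a / 2) / (2 - lam) < α ∧ α < a / lam := by
    refine exists_between ?_
    rw [div_lt_div_iff₀ hlam₂ hlam]
    linarith
  have hα₀ : 0 < α := (div_pos (by linarith) hlam₂).trans hα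
  rw [div_lt_iff₀' hlam₂] at hα
  rw [lt_div_iff₀' hlam] at hα'
  obtain ⟨ε, hε, hε'⟩ := exists_between (lt_min (sub_pos.2 hα) (sub_pos.2 hα'))
  rw [lt_min_iff] at hε'
  have : Finite (sys).preemptiveGreedy.Mem := inferInstanceAs (Finite Unit)
  refine Policy.stabilizes_of_generator_le _ ()
    (linearCombination_nonneg (weight_nonneg hα₀.le zero_le_one)) (Set.finite_singleton 0) hε
    fun x hx => ?_
  rw [Policy.generator_linearCombination]
  change (sys).valueDrift ((sys).greedyAssign x.1) _ ≤ -ε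
  rcases state_trichotomy x.1 with hn | hn | ⟨hn, hn'⟩
  · exact (hx hn).elim
  · rw [valueDrift_greedyAssign_of_zNew _ hn, weight_zNew, weight_zFailed]
    linarith
  · rw [valueDrift_greedyAssign_of_zFailed _ hn hn', weight_zNew, weight_zFailed]
    linarith

theorem exists_greedyAssign_ne_zero (hn : n ≠ 0) :
    ∃ s z, (sys).greedyAssign n s (some z) ≠ 0 ∧ (sys).psi s z < 1 := by
  refine ⟨0, ?_⟩
  rcases state_trichotomy n with hzero | hnew | ⟨hnew, hfailed⟩
  · exact (hn hzero).elim
  · exact ⟨zNew, by simp [greedyAssign_of_zNew hnew], psi_zero_zNew.trans_lt (by linarith)⟩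
  · exact ⟨zFailed, by simp [greedyAssign_of_zFailed hnew hfailed],
      psi_zero_zFailed.trans_lt (by linarith)⟩

-- With these weights the drift vanishes whenever only tasks of mixed type `z''` are outstanding.
theorem valueDrift_greedyAssign_nonneg (h : 4 * a / (2 + a) ≤ lam) (n : (sys).State) :
    0 ≤ (sys).valueDrift ((sys).greedyAssign n) (weight a lam) := by
  rw [div_le_iff₀ (by linarith)] at h
  rcases state_trichotomy n with rfl | hn | ⟨hn, hn'⟩
  · rw [valueDrift_greedyAssign_zero, weight_zNew]
    positivity
  · rw [valueDrift_greedyAssign_of_zNew _ hn, weight_zNew, weight_zFailed]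
    linarith
  · rw [valueDrift_greedyAssign_of_zFailed _ hn hn', weight_zNew, weight_zFailed]
    linarith

theorem lt_of_preemptiveGreedy_stabilizes (h : (sys).preemptiveGreedy.Stabilizes) :
    lam < 4 * a / (2 + a) := by
  obtain ⟨q, hq⟩ := (stabilizes_iff_exists_bind_step_eq _).1 h
  by_contra! hle
  obtain ⟨m, hm⟩ : ∃ m, q (0, m) ≠ 0 :=
    Policy.exists_zero_ne_zero_of_invariant _ hq
      fun x hx => exists_greedyAssign_ne_zero (n := x.1) hx
  have hzero := Policy.valueDrift_eq_zero_of_invariant (sys).preemptiveGreedy hq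
    (weight_nonneg ha₀.le hlam.le) (fun x => valueDrift_greedyAssign_nonneg hle x.1) hm
  replace hzero : (sys).valueDrift ((sys).greedyAssign 0) (weight a lam) = 0 := hzero
  rw [valueDrift_greedyAssign_zero, weight_zNew] at hzero
  exact (mul_pos hlam ha₀).ne' hzero

end PreemptiveGreedy

section Throughput

theorem arrivalRate_mul_le_of_isStabilizable (h : (sys).IsStabilizable) {α β c₀ c₁ : ℝ}
    (hα : 0 ≤ α) (hβ : 0 ≤ β) (hc₀ : 0 ≤ c₀) (hc₁ : 0 ≤ c₁)
    (hnew₀ : α - (1 - a) / 2 * β ≤ c₀) (hnew₁ : α - 1 / 2 * β ≤ c₁) (hfailed₀ : a * β ≤ c₀) :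
    lam * α ≤ c₀ + c₁ := by
  obtain ⟨P, hP⟩ := h
  have hcost : ∀ s z, weight α β z - (sys).psi s z * weight α β ((sys).phi s z) ≤ ![c₀, c₁] s := by
    simp only [Fin.forall_fin_two, forall_mixedType, phi_eq_zFailed, weight_zNew, weight_zFailed,
      psi_zero_zNew, psi_one_zNew, psi_zero_zFailed, psi_one_zFailed, Matrix.cons_val_zero,
      Matrix.cons_val_one]
    exact ⟨⟨hnew₀, by linarith⟩, hnew₁, by linarith⟩
  have hweak := hP.arrivalRate_mul_expect_le (weight_nonneg hα hβ)
    (Fin.forall_fin_two.2 ⟨hc₀, hc₁⟩) hcost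
  rw [expect_prior, weight_zNew] at hweak
  simpa [asymmetric, Fin.sum_univ_two] using hweak

theorem le_of_isStabilizable (h : (sys).IsStabilizable) : lam ≤ min (2 * a) (3 * a / (1 + a)) := by
  have hfirst : lam * (1 / 2) ≤ a + 0 :=
    arrivalRate_mul_le_of_isStabilizable h (β := 1) (by norm_num) zero_le_one ha₀.le le_rfl
      (by linarith) (by norm_num) (by linarith)
  have hsecond : lam * ((1 + a) / 2) ≤ a + a / 2 :=
    arrivalRate_mul_le_of_isStabilizable h (β := 1) (by linarith) zero_le_one ha₀.le (by linarith)
      (by linarith) (by linarith) (by linarith)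
  refine le_min (by linarith) ((le_div_iff₀ (by linarith)).2 (by linarith))

theorem valueDrift_twoPoint (x : Fin 2 → Set.Icc (0 : ℝ) 1) (w : (sys).Z → ℝ) :
    (sys).valueDrift (fun s => twoPoint (x s) (some zNew) (some zFailed)) w =
      (lam - (x 0 + x 1)) * w zNew +
        (x 0 * ((1 - a) / 2) + x 1 / 2 - a * (1 - x 0)) * w zFailed := by
  simp only [valueDrift_asymmetric, expect_twoPoint, attemptGain_some, psi_zero_zNew,
    psi_one_zNew, psi_zero_zFailed, psi_one_zFailed]
  ring

theorem isStabilizable_of_twoPoint (x : Fin 2 → Set.Icc (0 : ℝ) 1) (hnew : lam < x 0 + x 1)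
    (hfailed : x 0 * ((1 - a) / 2) + x 1 / 2 < a * (1 - x 0)) : (sys).IsStabilizable := by
  refine ⟨_, staticPolicy_stabilizes (σ := fun s => twoPoint (x s) (some zNew) (some zFailed))
    (forall_mixedType.2 ?_)⟩
  simp only [valueDrift_twoPoint, Pi.single_eq_same, Pi.single_eq_of_ne zFailed_ne_zNew,
    Pi.single_eq_of_ne zFailed_ne_zNew.symm]
  constructor <;> linarith

end Throughput

end Asymmetric

-- `y s` is the share of expert `s` devoted to `z'`; the witnesses are the optimal vertices of the
-- linear program that maximizes the throughput.
theorem exists_serviceSplit {a : ℝ} (ha₀ : 0 < a) (ha₁ : a < 1) :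
    ∃ y : Fin 2 → Set.Icc (0 : ℝ) 1, min (2 * a) (3 * a / (1 + a)) ≤ y 0 + y 1 ∧
      y 0 * ((1 - a) / 2) + (y 1 : ℝ) / 2 ≤ a * (1 - y 0) := by
  rcases le_total a (1 / 2) with ha | ha
  · refine ⟨![0, ⟨2 * a, by linarith, by linarith⟩], (min_le_left _ _).trans ?_, ?_⟩ <;> simp
  · have hp : 0 < 1 + a := by linarith
    have hy : (2 * a - 1) / (1 + a) ≤ 1 := (div_le_one hp).2 (by linarith)
    refine ⟨![⟨(2 * a - 1) / (1 + a), div_nonneg (by linarith) hp.le, hy⟩, 1],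
      (min_le_right _ _).trans ?_, ?_⟩
    all_goals
      simp
      field_simp
      linarith

theorem isStabilizable_of_lt {a lam : ℝ} {ha₀ : 0 < a} {ha₁ : a < 1} {hlam : 0 < lam}
    (h : lam < min (2 * a) (3 * a / (1 + a))) :
    (asymmetric a lam ha₀ ha₁ hlam).IsStabilizable := by
  obtain ⟨y, hsum, hflow⟩ := exists_serviceSplit ha₀ ha₁
  have hlam_lt : lam < y 0 + y 1 := h.trans_le hsum
  have hy : 0 < (y 0 + y 1 : ℝ) := hlam.trans hlam_lt
  obtain ⟨θ, hθ, hθ₁⟩ := exists_between ((div_lt_one hy).2 hlam_lt)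
  have hθ₀ : 0 < θ := (div_pos hlam hy).trans hθ
  rw [div_lt_iff₀ hy] at hθ
  let x (s : Fin 2) : Set.Icc (0 : ℝ) 1 := ⟨θ, hθ₀.le, hθ₁.le⟩ * y s
  have hx (s : Fin 2) : (x s : ℝ) = θ * y s := rfl
  refine isStabilizable_of_twoPoint x ?_ ?_
  · rwa [hx, hx, ← mul_add]
  · rw [hx, hx]
    nlinarith

theorem isLUB_isStabilizable {a : ℝ} (ha₀ : 0 < a) (ha₁ : a < 1) :
    IsLUB {lam : ℝ | ∃ hlam : 0 < lam, (asymmetric a lam ha₀ ha₁ hlam).IsStabilizable}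
      (min (2 * a) (3 * a / (1 + a))) := by
  constructor
  · rintro lam ⟨hlam, h⟩
    exact le_of_isStabilizable h
  · intro b hb
    have hopt : 0 < min (2 * a) (3 * a / (1 + a)) := lt_min (by positivity) (by positivity)
    by_contra! hlt
    obtain ⟨lam, hbelow, habove⟩ := exists_between (max_lt hlt hopt)
    rw [max_lt_iff] at hbelow
    exact (hb ⟨hbelow.2, isStabilizable_of_lt habove⟩).not_gt hbelow.1

theorem greedyThreshold_lt {a : ℝ} (ha₀ : 0 < a) (ha₁ : a < 1) :
    4 * a / (2 + a) < min (2 * a) (3 * a / (1 + a)) := by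
  refine lt_min ?_ ?_
  · rw [div_lt_iff₀ (by linarith)]
    nlinarith
  · rw [div_lt_div_iff₀ (by linarith) (by linarith)]
    nlinarith

end TaskExpert

end

theorem proposition3 (a : ℝ) (ha₀ : 0 < a) (ha₁ : a < 1) :
    (∀ (lam : ℝ) (hlam : 0 < lam),
      (TaskExpert.asymmetric a lam ha₀ ha₁ hlam).preemptiveGreedy.Stabilizes ↔
        lam < 4 * a / (2 + a)) ∧
    ∃ opt : ℝ,
      IsLUB {lam : ℝ | ∃ hlam : 0 < lam,
        (TaskExpert.asymmetric a lam ha₀ ha₁ hlam).IsStabilizable} opt ∧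
      4 * a / (2 + a) < opt ∧
      (a = 1 / 2 → 4 * a / (2 + a) = 4 / 5 ∧ opt = (1 + 25 / 100) * (4 * a / (2 + a))) := by
  refine ⟨fun lam hlam => ⟨TaskExpert.lt_of_preemptiveGreedy_stabilizes,
    TaskExpert.preemptiveGreedy_stabilizes⟩, min (2 * a) (3 * a / (1 + a)),
    TaskExpert.isLUB_isStabilizable ha₀ ha₁, TaskExpert.greedyThreshold_lt ha₀ ha₁, ?_⟩
  rintro rfl
  norm_num
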